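/- Let $\mathcal L$ be an essentially small tensor-triangulated category, i.e. a triangulated category with a symmetric monoidal structure $(\otimes,\mathbb 1)$ that is exact in each variable (with isomorphisms $X\otimes\Sigma Y\cong\Sigma(X\otimes Y)$ natural in both variables). For such a category $\mathcal C$, let $\mathrm{Spc}(\mathcal C)$ be the set of its prime tt-ideals, i.e. the proper thick triangulated $\otimes$-ideals $\mathcal P\subsetneq\mathcal C$ such that $X\otimes Y\in\mathcal P$ implies $X\in\mathcal P$ or $Y\in\mathcal P$. For a $\otimes$-invertible object $u\in\mathcal C$, let $R^\bullet_{\mathcal C,u}=\mathrm{Hom}_{\mathcal C}(\mathbb 1,u^{\otimes\bullet})$ be the associated $\mathbb Z$-graded ring, with the product of $f\colon\mathbb 1\to u^{\otimes m}$ and $g\colon\mathbb 1\to u^{\otimes n}$ given by $f\otimes g\colon\mathbb 1\to u^{\otimes m}\otimes u^{\otimes n}\cong u^{\otimes(m+n)}$; let $\mathrm{Spec}^\bullet(R^\bullet_{\mathcal C,u})$ be the set of its homogeneous prime ideals, and let $$\rho^\bullet_{\mathcal C,u}\colon\mathrm{Spc}(\mathcal C)\to\mathrm{Spec}^\bullet(R^\bullet_{\mathcal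 C,u})$$ be the comparison map, which sends $\mathcal P$ to the homogeneous prime ideal whose homogeneous elements are the $f$ with $\mathrm{cone}(f)\notin\mathcal P$. Let $u\in\mathcal L$ be $\otimes$-invertible and let $\mathcal K\subseteq\mathcal L$ be the full thick triangulated subcategory generated by $\{u^{\otimes n}\mid n\in\mathbb Z\}$ (a tensor-triangulated subcategory containing $u$). Suppose that $\mathcal K$ is rigid, i.e. every object of $\mathcal K$ has a dual in $\mathcal K$. Then: 1. The inclusion $\mathcal K\subseteq\mathcal L$ induces an isomorphism of graded rings $R^\bullet_{\mathcal K,u}=\mathrm{Hom}_{\mathcal K}(\mathbb 1,u^{\otimes\bullet})\cong\mathrm{Hom}_{\mathcal L}(\mathbb 1,u^{\otimes\bullet})=R^\bullet_{\mathcal L,u}$. 2. Under this identification, $\rho^\bullet_{\mathcal K,u}(\mathcal Q\cap\mathcal K)=\rho^\bullet_{\mathcal L,u}(\mathcal Q)$ for every $\mathcal Q\in\mathrm{Spc}(\mathcal L)$, and the map $\mathrm{Spc}(\mathcal L)\to\mathrm{Spc}(\mathcal K)$, $\mathcal Q\mapsto\mathcal Q\cap\mathcal K$, is surjective. 3. If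 $\rho^\bullet_{\mathcal K,u}$ is surjective, then $\rho^\bullet_{\mathcal L,u}$ is surjective. -/

import Mathlib

open CategoryTheory MonoidalCategory Limits

universe v u

set_option linter.unusedSectionVars false

namespace TTGeometry

noncomputable section

variable {C : Type u} [Category.{v} C] [MonoidalCategory C]

/-- An object `x` is `⊗`-invertible if `x ⊗ y ≅ 𝟙` for some `y`. -/
def IsTensorInvertible (x : C) : Prop :=
  ∃ y : C, Nonempty (x ⊗ y ≅ 𝟙_ C)

/-- The iterated tensor power `x^{⊗ n}`, for `n` a natural number. -/
def tensorNPow (x : C) : ℕ → C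
  | 0 => 𝟙_ C
  | n + 1 => tensorNPow x n ⊗ x

/-- A realization of the integral tensor powers of `x`: a `ℤ`-indexed family of objects, starting
with the unit, in which each step is `- ⊗ x`. (Such a family exists only if `x` is
`⊗`-invertible, and it is then unique up to isomorphism.) -/
structure TensorPowers (x : C) where
  /-- the object `x^{⊗ n}` -/
  obj : ℤ → C
  /-- `x^{⊗ 0}` is the unit -/
  zero : 𝟙_ C ≅ obj 0
  /-- `x^{⊗ n} ⊗ x` is `x^{⊗ (n + 1)}` -/
  succ (n : ℤ) : obj n ⊗ x ≅ obj (n + 1)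

namespace IsTensorInvertible

variable [SymmetricCategory C] {x : C} (hx : IsTensorInvertible x)
/-- A chosen `⊗`-inverse. -/
def inverse : C := hx.choose

/-- The isomorphism expressing that `inverse` is an inverse. -/
def inverseTensorIso : hx.inverse ⊗ x ≅ 𝟙_ C :=
  (β_ _ _) ≪≫ hx.choose_spec.some

/-- The integral tensor powers of a `⊗`-invertible object `x`: the usual ones in
non-negative degrees, and the powers of the inverse in negative degrees. -/
def powers : TensorPowers x where
  obj
    | Int.ofNat n => tensorNPow x n
    | Int.negSucc n => tensorNPow hx.inverse (n + 1)
  zero := Iso.refl _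
  succ
    | Int.ofNat _ => Iso.refl _
    | Int.negSucc 0 => α_ _ _ _ ≪≫ whiskerLeftIso _ hx.inverseTensorIso ≪≫ ρ_ _
    | Int.negSucc (_ + 1) => α_ _ _ _ ≪≫ whiskerLeftIso _ hx.inverseTensorIso ≪≫ ρ_ _

end IsTensorInvertible

namespace TensorPowers

variable {x : C} (T : TensorPowers x)

/-- The isomorphism `x^{⊗ a} ⊗ x ≅ x^{⊗ b}` when `a + 1 = b`. -/
def succ' (a b : ℤ) (h : a + 1 = b) : T.obj a ⊗ x ≅ T.obj b :=
  T.succ a ≪≫ eqToIso (by rw [h])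

/-- The identification `x^{⊗ a} ≅ x^{⊗ b}` when `a = b`. -/
def cast {a b : ℤ} (h : a = b) : T.obj a ≅ T.obj b := eqToIso (by rw [h])

@[simp] lemma cast_refl (a : ℤ) : T.cast (rfl : a = a) = Iso.refl _ := rfl

variable [SymmetricCategory C]

/-- An inverse of `x` coming from the powers. -/
def negOneIso : x ⊗ T.obj (-1) ≅ 𝟙_ C :=
  (β_ _ _) ≪≫ T.succ' (-1) 0 (by norm_num) ≪≫ T.zero.symm

lemma tensor_unit_naturality {y : C} (e : x ⊗ y ≅ 𝟙_ C) {X Y : C} (f : X ⟶ Y) :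
    f ≫ (ρ_ Y).inv ≫ Y ◁ e.inv ≫ (α_ Y x y).inv =
      ((ρ_ X).inv ≫ X ◁ e.inv ≫ (α_ X x y).inv) ≫ f ▷ x ▷ y := by
  have h : (α_ X x y).inv ≫ f ▷ x ▷ y = f ▷ (x ⊗ y) ≫ (α_ Y x y).inv := by simp
  simp only [Category.assoc, h, whisker_exchange_assoc]
  simp

lemma tensor_counit_naturality {y : C} (e : y ⊗ x ≅ 𝟙_ C) {X Y : C} (f : X ⟶ Y) :
    f ▷ y ▷ x ≫ (α_ Y y x).hom ≫ Y ◁ e.hom ≫ (ρ_ Y).hom =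
      ((α_ X y x).hom ≫ X ◁ e.hom ≫ (ρ_ X).hom) ≫ f := by
  simp only [Category.assoc, associator_naturality_left_assoc, ← whisker_exchange_assoc]
  simp

lemma isEquivalence_tensorRight {y : C} (e : x ⊗ y ≅ 𝟙_ C) : (tensorRight x).IsEquivalence := by
  let E : C ≌ C := CategoryTheory.Equivalence.mk (tensorRight x) (tensorRight y)
    (NatIso.ofComponents (fun X => (ρ_ X).symm ≪≫ whiskerLeftIso X e.symm ≪≫
        (α_ X x y).symm) (fun f => tensor_unit_naturality e f))
    (NatIso.ofComponents (fun X => α_ X y x ≪≫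
      whiskerLeftIso X ((β_ _ _) ≪≫ e) ≪≫ ρ_ X)
      (fun f => tensor_counit_naturality ((β_ _ _) ≪≫ e) f))
  exact E.isEquivalence_functor

/-- Tensoring with a `⊗`-invertible object is fully faithful. -/
def fullyFaithful (T : TensorPowers x) : (tensorRight x).FullyFaithful :=
  haveI := isEquivalence_tensorRight T.negOneIso
  Functor.FullyFaithful.ofFullyFaithful _

/-- If `a + 1 = b`, a map `X ⊗ x^{⊗ b} ≅ x^{⊗ (l + b)}` is obtained from a map
`X ⊗ x^{⊗ a} ≅ x^{⊗ (l + a)}` by tensoring with `x`. -/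
def mulUp (l : ℤ) {X : C} {a b : ℤ} (h : a + 1 = b) (p : X ⊗ T.obj a ≅ T.obj (l + a)) :
    X ⊗ T.obj b ≅ T.obj (l + b) :=
  whiskerLeftIso X (T.succ' a b h).symm ≪≫ (α_ _ _ _).symm ≪≫ whiskerRightIso p x ≪≫
    T.succ' (l + a) (l + b) (by lia)

/-- The inverse construction to `mulUp`. -/
def mulDown (l : ℤ) {X : C} {a b : ℤ} (h : a + 1 = b) (p : X ⊗ T.obj b ≅ T.obj (l + b)) :
    X ⊗ T.obj a ≅ T.obj (l + a) :=
  T.fullyFaithful.preimageIso (α_ _ _ _ ≪≫ whiskerLeftIso X (T.succ' a b h) ≪≫ p ≪≫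
    (T.succ' (l + a) (l + b) (by lia)).symm)

/-- The condition relating `p : X ⊗ x^{⊗ a} ⟶ x^{⊗ (l + a)}` and
`q : X ⊗ x^{⊗ b} ⟶ x^{⊗ (l + b)}`, when `a + 1 = b`, that `q` is `p ⊗ x`. -/
def MulRel (l : ℤ) {X : C} {a b : ℤ} (h : a + 1 = b) (p : X ⊗ T.obj a ⟶ T.obj (l + a))
    (q : X ⊗ T.obj b ⟶ T.obj (l + b)) : Prop :=
  p ▷ x ≫ (T.succ' (l + a) (l + b) (by lia)).hom =
    (α_ _ _ _).hom ≫ X ◁ (T.succ' a b h).hom ≫ q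

lemma mulRel_mulUp (l : ℤ) {X : C} {a b : ℤ} (h : a + 1 = b) (p : X ⊗ T.obj a ≅ T.obj (l + a)) :
    T.MulRel l h p.hom (T.mulUp l h p).hom := by
  simp [MulRel, mulUp]

lemma mulRel_mulDown (l : ℤ) {X : C} {a b : ℤ} (h : a + 1 = b)
    (p : X ⊗ T.obj b ≅ T.obj (l + b)) :
    T.MulRel l h (T.mulDown l h p).hom p.hom := by
  have := T.fullyFaithful.map_preimage (X := X ⊗ T.obj a) (Y := T.obj (l + a))
    ((α_ _ _ _).hom ≫ X ◁ (T.succ' a b h).hom ≫ p.hom ≫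
    (T.succ' (l + a) (l + b) (by lia)).inv)
  have h2 : (T.mulDown l h p).hom ▷ x = _ := this
  simp [MulRel, h2]

/-- The isomorphism `x^{⊗ m} ⊗ x^{⊗ n} ≅ x^{⊗ (m + n)}` for `n ≥ 0`. -/
def mulIsoNat (m : ℤ) : ∀ n : ℕ, T.obj m ⊗ T.obj (Int.ofNat n) ≅ T.obj (m + Int.ofNat n)
  | 0 => whiskerLeftIso _ T.zero.symm ≪≫ ρ_ _ ≪≫ T.cast (by simp)
  | n + 1 => T.mulUp m (a := Int.ofNat n) (by simp) (mulIsoNat m n)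

/-- The isomorphism `x^{⊗ m} ⊗ x^{⊗ n} ≅ x^{⊗ (m + n)}` for `n < 0`. -/
def mulIsoNeg (m : ℤ) : ∀ n : ℕ, T.obj m ⊗ T.obj (Int.negSucc n) ≅ T.obj (m + Int.negSucc n)
  | 0 => T.mulDown m (b := Int.ofNat 0) (by simp) (T.mulIsoNat m 0)
  | n + 1 => T.mulDown m (b := Int.negSucc n) (by lia) (mulIsoNeg m n)

/-- The canonical isomorphism `x^{⊗ m} ⊗ x^{⊗ n} ≅ x^{⊗ (m + n)}`: the unitor for `n = 0`,
and compatible with tensoring by `x` on the right. -/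
def mulIso (m : ℤ) : ∀ n : ℤ, T.obj m ⊗ T.obj n ≅ T.obj (m + n)
  | Int.ofNat n => T.mulIsoNat m n
  | Int.negSucc n => T.mulIsoNeg m n

lemma mulIso_zero (m : ℤ) :
    (T.mulIso m 0).hom = T.obj m ◁ T.zero.inv ≫ (ρ_ _).hom ≫ (T.cast (by simp)).hom := by
  rfl

lemma mulIso_rel (m : ℤ) {a b : ℤ} (h : a + 1 = b) :
    T.MulRel m h (T.mulIso m a).hom (T.mulIso m b).hom := by
  subst h
  match a with
  | Int.ofNat n =>
    exact T.mulRel_mulUp m (a := Int.ofNat n) (b := Int.ofNat (n + 1)) (by simp) (T.mulIsoNat m n)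
  | Int.negSucc 0 =>
    exact T.mulRel_mulDown m (a := Int.negSucc 0) (b := Int.ofNat 0) (by simp) (T.mulIsoNat m 0)
  | Int.negSucc (n + 1) =>
    exact T.mulRel_mulDown m (a := Int.negSucc (n + 1)) (b := Int.negSucc n) (by lia)
      (T.mulIsoNeg m n)

lemma MulRel.right_unique {l : ℤ} {X : C} {a b : ℤ} {h : a + 1 = b}
    {p : X ⊗ T.obj a ⟶ T.obj (l + a)} {q q' : X ⊗ T.obj b ⟶ T.obj (l + b)}
    (h₁ : T.MulRel l h p q) (h₂ : T.MulRel l h p q') : q = q' := by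
  have := h₁.symm.trans h₂
  rwa [cancel_epi, cancel_epi] at this

lemma MulRel.left_unique {l : ℤ} {X : C} {a b : ℤ} {h : a + 1 = b}
    {p p' : X ⊗ T.obj a ⟶ T.obj (l + a)} {q : X ⊗ T.obj b ⟶ T.obj (l + b)}
    (h₁ : T.MulRel l h p q) (h₂ : T.MulRel l h p' q) : p = p' := by
  have := h₁.trans h₂.symm
  rw [cancel_mono] at this
  exact T.fullyFaithful.map_injective this

lemma eq_of_mulRel {l : ℤ} {X : C} (p q : ∀ a, X ⊗ T.obj a ⟶ T.obj (l + a))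
    (hp : ∀ a, T.MulRel l rfl (p a) (p (a + 1))) (hq : ∀ a, T.MulRel l rfl (q a) (q (a + 1)))
    (h0 : p 0 = q 0) (a : ℤ) : p a = q a := by
  induction a using Int.induction_on with
  | zero => exact h0
  | succ n ih => exact MulRel.right_unique T (hp n) (ih ▸ hq n)
  | pred n ih =>
    have h1 := hp (-(n : ℤ) - 1)
    have h2 := hq (-(n : ℤ) - 1)
    have e : p (-(n : ℤ) - 1 + 1) = q (-(n : ℤ) - 1 + 1) := by
      rw [show -(n : ℤ) - 1 + 1 = -(n : ℤ) by lia]; exact ih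
    exact MulRel.left_unique T (e ▸ h1) h2

lemma succ'_cast {a b b' : ℤ} (h : a + 1 = b) (h' : b = b') :
    (T.succ' a b h).hom ≫ (T.cast h').hom = (T.succ' a b' (h.trans h')).hom := by
  subst h'; simp

lemma cast_succ' {a a' b : ℤ} (h : a' + 1 = b) (h' : a = a') :
    (T.cast h').hom ▷ x ≫ (T.succ' a' b h).hom = (T.succ' a b (by lia)).hom := by
  subst h'; simp

@[simp] lemma cast_cast {a b c : ℤ} (h : a = b) (h' : b = c) :
    (T.cast h).hom ≫ (T.cast h').hom = (T.cast (h.trans h')).hom := by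
  subst h h'; simp

lemma cast_mulIso {a a' b : ℤ} (h : a = a') :
    (T.cast h).hom ▷ T.obj b ≫ (T.mulIso a' b).hom =
      (T.mulIso a b).hom ≫ (T.cast (by rw [h])).hom := by
  subst h; simp

lemma mulIso_cast {a b b' : ℤ} (h : b = b') :
    T.obj a ◁ (T.cast h).hom ≫ (T.mulIso a b').hom =
      (T.mulIso a b).hom ≫ (T.cast (by rw [h])).hom := by
  subst h; simp

lemma zero_mulIso (n : ℤ) :
    T.zero.hom ▷ T.obj n ≫ (T.mulIso 0 n).hom = (λ_ _).hom ≫ (T.cast (by simp)).hom := by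
  refine T.eq_of_mulRel (l := 0) (X := 𝟙_ C)
    (fun n => T.zero.hom ▷ T.obj n ≫ (T.mulIso 0 n).hom)
    (fun n => (λ_ _).hom ≫ (T.cast (by simp)).hom) ?_ ?_ ?_ n
  · intro a
    have := T.mulIso_rel 0 (a := a) rfl
    dsimp [MulRel] at this ⊢
    rw [comp_whiskerRight_assoc, this]
    simp only [whisker_exchange_assoc, associator_naturality_left_assoc]
  · intro a
    dsimp [MulRel]
    rw [comp_whiskerRight_assoc, cast_succ']
    simp [succ'_cast]
  · rw [mulIso_zero, ← whisker_exchange_assoc, ← cancel_epi (𝟙_ C ◁ T.zero.hom)]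
    simp [← unitors_equal]

lemma mulIso_assoc (m n k : ℤ) :
    (T.mulIso m n).hom ▷ T.obj k ≫ (T.mulIso (m + n) k).hom =
      (α_ _ _ _).hom ≫ T.obj m ◁ (T.mulIso n k).hom ≫ (T.mulIso m (n + k)).hom ≫
        (T.cast (by lia)).hom := by
  refine T.eq_of_mulRel (l := m + n) (X := T.obj m ⊗ T.obj n)
    (fun k => (T.mulIso m n).hom ▷ T.obj k ≫ (T.mulIso (m + n) k).hom)
    (fun k => (α_ _ _ _).hom ≫ T.obj m ◁ (T.mulIso n k).hom ≫ (T.mulIso m (n + k)).hom ≫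
        (T.cast (by lia)).hom) ?_ ?_ ?_ k
  · intro a
    have := T.mulIso_rel (m + n) (a := a) rfl
    dsimp [MulRel] at this ⊢
    rw [comp_whiskerRight_assoc, this]
    simp only [whisker_exchange_assoc, associator_naturality_left_assoc]
  · intro a
    have h1 := T.mulIso_rel n (a := a) rfl
    have h2 := T.mulIso_rel m (a := n + a) (b := n + (a + 1)) (by lia)
    dsimp [MulRel] at h1 h2 ⊢
    simp only [comp_whiskerRight, Category.assoc]
    rw [cast_succ', ← succ'_cast T (b := m + (n + (a + 1))) (by lia) (by lia), reassoc_of% h2    ]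
    have h3 : T.obj m ◁ ((T.mulIso n a).hom ▷ x) ≫ T.obj m ◁ (T.succ' (n + a) (n + (a + 1)) (by lia)).hom = _ :=
      (MonoidalCategory.whiskerLeft_comp _ _ _).symm.trans (congrArg (fun f => T.obj m ◁ f) h1)
    simp only [MonoidalCategory.whiskerLeft_comp] at h3
    simp only [associator_naturality_middle_assoc, reassoc_of% h3,
      pentagon_assoc, associator_naturality_right_assoc]
  · have h := T.mulIso_cast (a := m) (b := n) (b' := n + 0) (by simp)
    simp only [mulIso_zero, ← whisker_exchange_assoc, MonoidalCategory.whiskerLeft_comp, Category.assoc,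
      rightUnitor_naturality_assoc]
    rw [reassoc_of% h]
    simp

/-- The degree `n` part `Hom(𝟙, x^{⊗ n})` of the graded ring `Hom(𝟙, x^{⊗ •})`. -/
abbrev R (n : ℤ) : Type v := 𝟙_ C ⟶ T.obj n

/-- The product of `f : 𝟙 ⟶ x^{⊗ m}` and `g : 𝟙 ⟶ x^{⊗ n}` is `f ⊗ g`, viewed as a morphism
`𝟙 ≅ 𝟙 ⊗ 𝟙 ⟶ x^{⊗ m} ⊗ x^{⊗ n} ≅ x^{⊗ (m + n)}`. -/
def mul {m n : ℤ} (f : T.R m) (g : T.R n) : T.R (m + n) :=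
  (λ_ (𝟙_ C)).inv ≫ (f ⊗ₘ g) ≫ (T.mulIso m n).hom

lemma gradedMonoid_ext {a b : ℤ} (h : a = b) (f : T.R a) (g : T.R b)
    (hfg : f ≫ (T.cast h).hom = g) : GradedMonoid.mk (A := T.R) a f = GradedMonoid.mk b g := by
  subst h hfg
  simp

instance : GradedMonoid.GMul T.R where
  mul f g := T.mul f g

instance : GradedMonoid.GOne T.R where
  one := T.zero.hom

instance : GradedMonoid.GMonoid T.R where
  one_mul := by
    rintro ⟨n, f⟩
    refine T.gradedMonoid_ext (zero_add n) (T.mul T.zero.hom f) f ?_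
    simp only [mul, tensorHom_def', Category.assoc, reassoc_of% T.zero_mulIso]
    simp
  mul_one := by
    rintro ⟨n, f⟩
    refine T.gradedMonoid_ext (add_zero n) (T.mul f T.zero.hom) f ?_
    simp only [mul, MonoidalCategory.tensorHom_def, Category.assoc, mulIso_zero]
    simp [unitors_inv_equal]
  mul_assoc := by
    rintro ⟨m, f⟩ ⟨n, g⟩ ⟨k, h⟩
    refine T.gradedMonoid_ext (add_assoc m n k) (T.mul (T.mul f g) h) (T.mul f (T.mul g h)) ?_
    have e : T.mul f g ⊗ₘ h = (λ_ (𝟙_ C)).inv ▷ 𝟙_ C ≫ ((f ⊗ₘ g) ⊗ₘ h) ≫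
        (T.mulIso m n).hom ▷ T.obj k := by
      simp only [mul, ← tensorHom_id, tensorHom_comp_tensorHom, Category.id_comp,
        Category.comp_id]
    have e' : f ⊗ₘ T.mul g h = 𝟙_ C ◁ (λ_ (𝟙_ C)).inv ≫ (f ⊗ₘ (g ⊗ₘ h)) ≫
        T.obj m ◁ (T.mulIso n k).hom := by
      simp only [mul, ← id_tensorHom, tensorHom_comp_tensorHom, Category.id_comp,
        Category.comp_id]
    rw [mul, e, mul, e']
    simp only [Category.assoc, reassoc_of% T.mulIso_assoc, cast_cast, cast_refl, Iso.refl_hom,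
      Category.comp_id, associator_naturality_assoc]
    have c : (λ_ (𝟙_ C)).inv ≫ (λ_ (𝟙_ C)).inv ▷ 𝟙_ C ≫ (α_ _ _ _).hom =
        (λ_ (𝟙_ C)).inv ≫ 𝟙_ C ◁ (λ_ (𝟙_ C)).inv := by monoidal
    rw [reassoc_of% c]

variable [Preadditive C] [MonoidalPreadditive C]

instance : DirectSum.GRing T.R where
  mul_zero f := by change T.mul f 0 = 0; simp [mul]
  zero_mul f := by change T.mul 0 f = 0; simp [mul]
  mul_add f g h := by
    change T.mul f (g + h) = T.mul f g + T.mul f h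
    simp [mul, MonoidalPreadditive.tensor_add]
  add_mul f g h := by
    change T.mul (f + g) h = T.mul f h + T.mul g h
    simp [mul, MonoidalPreadditive.add_tensor]
  natCast n := n • T.zero.hom
  natCast_zero := by simp
  natCast_succ n := by simp [add_smul]; rfl
  intCast n := n • T.zero.hom
  intCast_ofNat n := by simp
  intCast_negSucc_ofNat n := by simp [Int.negSucc_eq, add_smul]

end TensorPowers
section TensorTriangulated

variable (C) [SymmetricCategory C] [Preadditive C] [HasZeroObject C] [HasShift C ℤ]
  [∀ n : ℤ, (shiftFunctor C n).Additive] [Pretriangulated C]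

/-- The compatibility between a symmetric monoidal structure and a triangulation: the tensor
product is exact in each variable. It suffices to say it for the functors `X ⊗ -`, thanks to the
symmetry. The isomorphisms `X ⊗ Y⟦n⟧ ≅ (X ⊗ Y)⟦n⟧` are natural in both variables. -/
class TensorTriangulated where
  /-- `X ⊗ -` commutes with the shift -/
  commShift (X : C) : (tensorLeft X).CommShift ℤ
  /-- `X ⊗ -` preserves distinguished triangles -/
  isTriangulated (X : C) : (tensorLeft X).IsTriangulated
  /-- the isomorphisms `X ⊗ Y⟦n⟧ ≅ (X ⊗ Y)⟦n⟧` are natural in `X` -/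
  natural {X Y : C} (f : X ⟶ Y) : NatTrans.CommShift ((curriedTensor C).map f) ℤ

attribute [reducible] TensorTriangulated.commShift
attribute [instance] TensorTriangulated.commShift TensorTriangulated.isTriangulated
  TensorTriangulated.natural

variable [TensorTriangulated C]
variable {C}

instance monoidalPreadditive : MonoidalPreadditive C where
  whiskerLeft_zero {X Y Z} := (tensorLeft X).map_zero Y Z
  whiskerLeft_add {X Y Z} f g := (tensorLeft X).map_add
  zero_whiskerRight {X Y Z} := by
    have h : X ◁ (0 : Y ⟶ Z) = 0 := (tensorLeft X).map_zero Y Z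
    have := BraidedCategory.braiding_naturality_left (0 : Y ⟶ Z) X
    rwa [h, comp_zero, ← zero_comp (f := (β_ Z X).hom), cancel_mono] at this
  add_whiskerRight {X Y Z} f g := by
    have h : X ◁ (f + g) = X ◁ f + X ◁ g := (tensorLeft X).map_add
    have := BraidedCategory.braiding_naturality_left (f + g) X
    rw [h, Preadditive.comp_add, ← BraidedCategory.braiding_naturality_left,
      ← BraidedCategory.braiding_naturality_left, ← Preadditive.add_comp, cancel_mono] at this
    exact this

section FullSubcategory

variable (P : ObjectProperty C) [P.IsMonoidal] [P.IsTriangulated]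

/-- The functor `X ⊗ -` of a full monoidal subcategory is the restriction of the ambient one. -/
def tensorLeftCompι (X : P.FullSubcategory) :
    tensorLeft X ⋙ P.ι ≅ P.ι ⋙ tensorLeft X.obj :=
  NatIso.ofComponents (fun _ => Iso.refl _) (fun f => by simp)

/-- A triangulated full subcategory closed under tensor products is tensor triangulated. -/
instance tensorTriangulatedFullSubcategory : TensorTriangulated P.FullSubcategory where
  commShift X := Functor.CommShift.ofComp (tensorLeftCompι P X) ℤ
  isTriangulated X := by
    let := Functor.CommShift.ofComp (tensorLeftCompι P X) ℤ
    have : NatTrans.CommShift (tensorLeftCompι P X).hom ℤ :=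
      Functor.CommShift.ofComp_compatibility (tensorLeftCompι P X) ℤ
    rw [Functor.isTriangulated_iff_comp_right (tensorLeftCompι P X)]
    infer_instance
  natural {X Y} f := by
    let := Functor.CommShift.ofComp (tensorLeftCompι P X) ℤ
    let := Functor.CommShift.ofComp (tensorLeftCompι P Y) ℤ
    refine ⟨fun n => NatTrans.ext (funext fun Z => P.ι.map_injective ?_)⟩
    have key (W : P.FullSubcategory) :
        P.ι.map ((Functor.CommShift.OfComp.iso (tensorLeftCompι P W) n).hom.app Z) =
          W.obj ◁ (P.ι.commShiftIso n).hom.app Z ≫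
            ((tensorLeft W.obj).commShiftIso n).hom.app Z.obj ≫
              (P.ι.commShiftIso n).inv.app (W ⊗ Z) := by
      refine (Functor.CommShift.OfComp.map_iso_hom_app (tensorLeftCompι P W) n Z).trans ?_
      have h1 : (tensorLeftCompι P W).hom.app (Z⟦n⟧) = 𝟙 _ := rfl
      have h2 : (tensorLeftCompι P W).inv.app Z = 𝟙 _ := rfl
      rw [h1, h2, CategoryTheory.Functor.map_id]
      refine (Category.id_comp _).trans ?_
      rw [Functor.commShiftIso_comp_hom_app, Category.assoc]
      exact congrArg _ (congrArg _ (Category.id_comp _))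
    have hZ := NatTrans.shift_app_comm ((curriedTensor C).map f.hom) n Z.obj
    have hn := P.ι.commShiftIso_inv_naturality (f ▷ Z) n
    have hw := whisker_exchange f.hom ((P.ι.commShiftIso n).hom.app Z)
    change P.ι.map ((Functor.CommShift.OfComp.iso (tensorLeftCompι P X) n).hom.app Z ≫
      (f ▷ Z)⟦n⟧') = P.ι.map (f ▷ Z⟦n⟧ ≫
        (Functor.CommShift.OfComp.iso (tensorLeftCompι P Y) n).hom.app Z)
    rw [Functor.map_comp, Functor.map_comp, key X, key Y]
    simp only [Category.assoc]
    refine (congrArg _ (congrArg _ hn.symm)).trans ?_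
    have hZ' := hZ =≫ (P.ι.commShiftIso n).inv.app (Y ⊗ Z)
    simp only [Category.assoc] at hZ'
    refine (congrArg _ hZ').trans ?_
    have hw' := hw =≫ (((tensorLeft Y.obj).commShiftIso n).hom.app Z.obj ≫
              (P.ι.commShiftIso n).inv.app (Y ⊗ Z))
    simp only [Category.assoc] at hw'
    exact hw'

end FullSubcategory

end TensorTriangulated

section Cellular

variable [SymmetricCategory C] [Preadditive C] [HasZeroObject C] [HasShift C ℤ]
  [∀ n : ℤ, (shiftFunctor C n).Additive] [Pretriangulated C] [IsTriangulated C]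
  [TensorTriangulated C]

/-- The full thick triangulated subcategory generated by the tensor powers `x^{⊗ n}`, `n ∈ ℤ`. -/
abbrev TensorPowers.cellular {x : C} (T : TensorPowers x) : ObjectProperty C :=
  (ObjectProperty.ofObj T.obj).triangEnvelope

namespace TensorPowers

variable {x : C} (T : TensorPowers x)

instance : (ObjectProperty.ofObj T.obj).Nonempty := ⟨⟨T.obj 0, ⟨0⟩⟩⟩

lemma cellular_obj (n : ℤ) : T.cellular (T.obj n) :=
  ObjectProperty.le_triangEnvelope _ _ ⟨n⟩

instance cellular_isMonoidal : T.cellular.IsMonoidal where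
  prop_unit := T.cellular.prop_of_iso T.zero.symm (T.cellular_obj 0)
  prop_tensor := by
    intro X Y hX hY
    have step (Z : C) (hZ : ∀ n, T.cellular (Z ⊗ T.obj n)) :
        T.cellular ≤ T.cellular.inverseImage (tensorLeft Z) := by
      have : (T.cellular.inverseImage (tensorLeft Z)).IsStableUnderRetracts :=
        ⟨fun r h => T.cellular.prop_of_retract (r.map (tensorLeft Z)) h⟩
      rw [ObjectProperty.triangEnvelope_le_iff]
      rintro _ ⟨n⟩
      exact hZ n
    have h1 (m : ℤ) : T.cellular (Y ⊗ T.obj m) :=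
      T.cellular.prop_of_iso (β_ _ _) (step (T.obj m) (fun n =>
        T.cellular.prop_of_iso (T.mulIso m n).symm (T.cellular_obj _)) _ hY)
    exact T.cellular.prop_of_iso (β_ _ _) (step Y h1 _ hX)

lemma cellular_self : T.cellular x :=
  T.cellular.prop_of_iso ((T.succ' 0 1 (by norm_num)).symm ≪≫
    whiskerRightIso T.zero.symm x ≪≫ λ_ x) (T.cellular_obj 1)

/-- The tensor powers of `x` in the cellular subcategory are those of the ambient category. -/
def restrict : TensorPowers (⟨x, T.cellular_self⟩ : T.cellular.FullSubcategory) where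
  obj n := ⟨T.obj n, T.cellular_obj n⟩
  zero := T.cellular.isoMk T.zero
  succ n := T.cellular.isoMk (T.succ n)

end TensorPowers

end Cellular

section Spectrum

variable (C) [SymmetricCategory C] [Preadditive C] [HasZeroObject C] [HasShift C ℤ]
  [∀ n : ℤ, (shiftFunctor C n).Additive] [Pretriangulated C]

/-- The spectrum `Spc C` of a tensor triangulated category: the set of prime tt-ideals, that is,
of proper thick triangulated `⊗`-ideals `P` such that `X ⊗ Y ∈ P` implies `X ∈ P` or `Y ∈ P`. -/
structure Spc where
  /-- membership in the prime -/
  prop : ObjectProperty C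
  isTriangulated : prop.IsTriangulated
  isThick : prop.IsStableUnderRetracts
  tensor_mem (X Y : C) : prop Y → prop (X ⊗ Y)
  ne_top : prop ≠ ⊤
  mem_or_mem (X Y : C) : prop (X ⊗ Y) → prop X ∨ prop Y

/-- The homogeneous spectrum `Spec^•` of a `ℤ`-graded ring: the set of homogeneous prime ideals.
A homogeneous ideal is given by its graded pieces. -/
structure HomogeneousSpec (A : ℤ → Type*) [∀ n, AddCommGroup (A n)] [DirectSum.GRing A] where
  /-- the degree `n` part of the ideal -/
  piece (n : ℤ) : AddSubgroup (A n)
  mul_mem_left {m n : ℤ} (a : A m) {b : A n} :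
    b ∈ piece n → GradedMonoid.GMul.mul a b ∈ piece (m + n)
  mul_mem_right {m n : ℤ} {a : A m} (b : A n) :
    a ∈ piece m → GradedMonoid.GMul.mul a b ∈ piece (m + n)
  one_notMem : GradedMonoid.GOne.one ∉ piece 0
  mem_or_mem {m n : ℤ} (a : A m) (b : A n) :
    GradedMonoid.GMul.mul a b ∈ piece (m + n) → a ∈ piece m ∨ b ∈ piece n

end Spectrum

section Comparison

variable [SymmetricCategory C]

/-- The action `X ≅ 𝟙 ⊗ X ⟶ w ⊗ X` of a morphism `a : 𝟙 ⟶ w` on an object `X`. -/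
def act {w : C} (a : 𝟙_ C ⟶ w) (X : C) : X ⟶ w ⊗ X := (λ_ X).inv ≫ a ▷ X

lemma act_naturality {w : C} (a : 𝟙_ C ⟶ w) {X Y : C} (φ : X ⟶ Y) :
    φ ≫ act a Y = act a X ≫ w ◁ φ := by
  simp [act, ← whisker_exchange]

lemma act_tensor {w : C} (a : 𝟙_ C ⟶ w) (X Y : C) :
    act a (X ⊗ Y) = act a X ▷ Y ≫ (α_ w X Y).hom := by
  simp [act]

lemma act_comp_act {w w' : C} (a : 𝟙_ C ⟶ w) (b : 𝟙_ C ⟶ w') (X : C) :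
    act (b ≫ act a w') X = act b X ≫ act a (w' ⊗ X) ≫ (α_ w w' X).inv := by
  simp [act]

lemma TensorPowers.mul_eq {x : C} (T : TensorPowers x) {m n : ℤ} (a : T.R m) (b : T.R n) :
    T.mul a b = (b ≫ act a (T.obj n)) ≫ (T.mulIso m n).hom := by
  simp [mul, act, tensorHom_def']

lemma scalar_comp {w : C} (σ : 𝟙_ C ⟶ 𝟙_ C) (f : 𝟙_ C ⟶ w) :
    σ ≫ f = f ≫ (λ_ w).inv ≫ σ ▷ w ≫ (λ_ w).hom := by
  have h : f ≫ (λ_ w).inv ≫ σ ▷ w = (λ_ _).inv ≫ σ ▷ 𝟙_ C ≫ 𝟙_ C ◁ f := by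
    rw [← whisker_exchange]; simp
  rw [reassoc_of% h]
  simp [unitors_inv_equal, unitors_equal]

/-- For a `⊗`-invertible object `w`, the symmetry of `w ⊗ w` is given by an endomorphism of `w`. -/
lemma exists_braiding_eq {w y : C} (e : w ⊗ y ≅ 𝟙_ C) : ∃ θ : w ⟶ w, (β_ w w).hom = θ ▷ w := by
  have := TensorPowers.isEquivalence_tensorRight e
  obtain ⟨θ, hθ⟩ := (tensorRight w).map_surjective (X := w) (Y := w) (β_ w w).hom
  exact ⟨θ, hθ.symm⟩

variable [Preadditive C] [HasZeroObject C] [HasShift C ℤ]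
  [∀ n : ℤ, (shiftFunctor C n).Additive] [Pretriangulated C] [TensorTriangulated C]

lemma act_add {w : C} (a b : 𝟙_ C ⟶ w) (X : C) : act (a + b) X = act a X + act b X := by
  simp [act]

open Pretriangulated

/-- A morphism `f : 𝟙 ⟶ w` with `w` invertible squares to zero on its cone. -/
lemma act_act_cone {w y : C} (e : w ⊗ y ≅ 𝟙_ C) (f : 𝟙_ C ⟶ w) {c : C} (g : w ⟶ c)
    (h : c ⟶ (𝟙_ C)⟦(1 : ℤ)⟧) (hT : Triangle.mk f g h ∈ distTriang C) :
    act f c ≫ act f (w ⊗ c) = 0 := by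
  obtain ⟨θ, hθ⟩ := exists_braiding_eq e
  have hfg : f ≫ g = 0 := comp_distTriang_mor_zero₁₂ _ hT
  have hhf : h ≫ f⟦(1 : ℤ)⟧' = 0 := comp_distTriang_mor_zero₃₁ _ hT
  have h1 : g ≫ act f c = 0 := by
    have h2 : f ▷ w = (β_ (𝟙_ C) w).hom ≫ w ◁ f ≫ θ ▷ w := by
      rw [← hθ, ← BraidedCategory.braiding_naturality_left_assoc]
      simp
    rw [act_naturality, act, h2]
    simp only [Category.assoc]
    rw [← whisker_exchange, ← MonoidalCategory.whiskerLeft_comp_assoc, hfg]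
    simp
  obtain ⟨k, hk⟩ : ∃ k : (𝟙_ C)⟦(1 : ℤ)⟧ ⟶ w ⊗ c, act f c = h ≫ k :=
    Triangle.yoneda_exact₃ _ hT (act f c) h1
  have h3 : h ≫ act f ((𝟙_ C)⟦(1 : ℤ)⟧) = 0 := by
    let cs (X : C) : X ⊗ (𝟙_ C)⟦(1 : ℤ)⟧ ≅ (X ⊗ 𝟙_ C)⟦(1 : ℤ)⟧ :=
      ((tensorLeft X).commShiftIso (1 : ℤ)).app (𝟙_ C)
    have hn : (cs (𝟙_ C)).hom ≫ (f ▷ 𝟙_ C)⟦(1 : ℤ)⟧' = f ▷ (𝟙_ C)⟦(1 : ℤ)⟧ ≫ (cs w).hom :=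
      NatTrans.shift_app_comm ((curriedTensor C).map f) (1 : ℤ) (𝟙_ C)
    obtain ⟨σ, hσ⟩ := (shiftFunctor C (1 : ℤ)).map_surjective
      ((λ_ _).inv ≫ (cs (𝟙_ C)).hom ≫ (ρ_ (𝟙_ C)).hom⟦(1 : ℤ)⟧')
    have h4 : act f ((𝟙_ C)⟦(1 : ℤ)⟧) ≫ (cs w).hom ≫ (ρ_ w).hom⟦(1 : ℤ)⟧' =
        f⟦(1 : ℤ)⟧' ≫ ((λ_ w).inv ≫ σ ▷ w ≫ (λ_ w).hom)⟦(1 : ℤ)⟧' := by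
      rw [← Functor.map_comp, ← scalar_comp, Functor.map_comp, hσ, act]
      simp only [Category.assoc]
      rw [← reassoc_of% hn, ← Functor.map_comp, ← Functor.map_comp, rightUnitor_naturality]
    rw [← cancel_mono ((cs w).hom ≫ (ρ_ w).hom⟦(1 : ℤ)⟧'), Category.assoc, h4,
      reassoc_of% hhf, zero_comp, zero_comp]
  rw [hk, Category.assoc, act_naturality, reassoc_of% h3, zero_comp]

lemma act_act_of_iso {w : C} (f : 𝟙_ C ⟶ w) {X Y : C} (e : X ≅ Y)
    (h : act f X ≫ act f (w ⊗ X) = 0) : act f Y ≫ act f (w ⊗ Y) = 0 := by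
  have : e.hom ≫ act f Y ≫ act f (w ⊗ Y) = 0 := by
    rw [reassoc_of% act_naturality, act_naturality, reassoc_of% h, zero_comp]
  rwa [← comp_zero (f := e.hom), cancel_epi] at this

lemma act_act_tensor {w : C} (f : 𝟙_ C ⟶ w) (X Y : C)
    (h : act f X ≫ act f (w ⊗ X) = 0) : act f (X ⊗ Y) ≫ act f (w ⊗ X ⊗ Y) = 0 := by
  rw [act_tensor, Category.assoc, act_naturality, act_tensor, Category.assoc,
    ← comp_whiskerRight_assoc, h]
  simp

namespace Spc

variable (P : Spc C)

attribute [instance] Spc.isTriangulated Spc.isThick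

lemma unit_notMem : ¬ P.prop (𝟙_ C) := fun h =>
  P.ne_top (top_le_iff.1 fun X _ => P.prop.prop_of_iso (ρ_ X) (P.tensor_mem X _ h))

lemma mem_of_trW_zero {X Y : C} {f : X ⟶ Y} (h : P.prop.trW f) (hf : f = 0) : P.prop X := by
  subst hf
  obtain ⟨Z, g, k, hT, hZ⟩ := (P.prop.trW_iff _).1 h
  obtain ⟨r, hr⟩ := Triangle.coyoneda_exact₁ _ hT (𝟙 (X⟦(1 : ℤ)⟧))
    (by exact (Category.id_comp _).trans (Functor.map_zero _ _ _))
  have : P.prop (X⟦(1 : ℤ)⟧) := P.prop.prop_of_retract ⟨r, k, hr.symm⟩ hZ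
  exact P.prop.prop_of_iso ((shiftEquiv C (1 : ℤ)).unitIso.symm.app X)
    (P.prop.le_shift (-1 : ℤ) _ this)

variable [IsTriangulated C]

lemma trW_act {w : C} {a : 𝟙_ C ⟶ w} (h : P.prop.trW a) (X : C) : P.prop.trW (act a X) := by
  obtain ⟨Z, g, k, hT, hZ⟩ := (P.prop.trW_iff _).1 h
  have h1 : P.prop.trW (X ◁ a) :=
    ObjectProperty.trW.mk _ ((tensorLeft X).map_distinguished _ hT) (P.tensor_mem X Z hZ)
  have h2 : act a X = (ρ_ X).inv ≫ X ◁ a ≫ (β_ X w).hom := by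
    rw [BraidedCategory.braiding_naturality_right]
    simp [act]
  rw [h2]
  exact P.prop.trW.comp_mem _ _ (P.prop.trW_of_isIso _)
    (P.prop.trW.comp_mem _ _ h1 (P.prop.trW_of_isIso _))

lemma not_trW_add {w y : C} (e : w ⊗ y ≅ 𝟙_ C) {f g : 𝟙_ C ⟶ w} (hf : ¬ P.prop.trW f)
    (hg : ¬ P.prop.trW g) : ¬ P.prop.trW (f + g) := by
  intro h
  obtain ⟨cf, f₂, f₃, hTf⟩ := distinguished_cocone_triangle f
  obtain ⟨cg, g₂, g₃, hTg⟩ := distinguished_cocone_triangle g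
  have F := act_act_tensor f cf cg (act_act_cone e f f₂ f₃ hTf)
  have G := act_act_of_iso g (β_ cg cf) (act_act_tensor g cg cf (act_act_cone e g g₂ g₃ hTg))
  set c := cf ⊗ cg
  have hz : act (f + g) c ≫ act (f + g) (w ⊗ c) ≫ act (f + g) (w ⊗ w ⊗ c) = 0 := by
    have key (a b : 𝟙_ C ⟶ w) (ha : act a c ≫ act a (w ⊗ c) = 0) :
        act a c ≫ act b (w ⊗ c) ≫ act a (w ⊗ w ⊗ c) = 0 ∧
          act b c ≫ act a (w ⊗ c) ≫ act a (w ⊗ w ⊗ c) = 0 := by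
      constructor
      · rw [act_naturality, reassoc_of% ha, zero_comp]
      · rw [reassoc_of% act_naturality, act_naturality, reassoc_of% ha, zero_comp]
    simp only [act_add, Preadditive.add_comp, Preadditive.comp_add, (key f g F).1, (key f g F).2,
      (key g f G).1, (key g f G).2, reassoc_of% F, reassoc_of% G, zero_comp, add_zero]
  have hc : P.prop c := P.mem_of_trW_zero (P.prop.trW.comp_mem _ _ (P.trW_act h _)
    (P.prop.trW.comp_mem _ _ (P.trW_act h _) (P.trW_act h _))) hz
  rcases P.mem_or_mem _ _ hc with hc | hc
  · exact hf (ObjectProperty.trW.mk _ hTf hc)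
  · exact hg (ObjectProperty.trW.mk _ hTg hc)

lemma not_trW_left {w y w' : C} (e : w ⊗ y ≅ 𝟙_ C) {a : 𝟙_ C ⟶ w} (ha : ¬ P.prop.trW a)
    (b : 𝟙_ C ⟶ w') : ¬ P.prop.trW (b ≫ act a w') := by
  intro h
  obtain ⟨c, a₂, a₃, hT⟩ := distinguished_cocone_triangle a
  have A := act_act_cone e a a₂ a₃ hT
  have hz : act (b ≫ act a w') c ≫ act (b ≫ act a w') ((w ⊗ w') ⊗ c) = 0 := by
    have A' : act b c ≫ act a (w' ⊗ c) ≫ act a (w ⊗ w' ⊗ c) = 0 := by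
      rw [reassoc_of% act_naturality, act_naturality, reassoc_of% A, zero_comp]
    have h2 := act_naturality a ((α_ w w' c).inv ≫ act b ((w ⊗ w') ⊗ c))
    simp only [Category.assoc] at h2
    rw [act_comp_act, act_comp_act]
    simp only [Category.assoc]
    rw [reassoc_of% h2, reassoc_of% A', zero_comp]
  exact ha (ObjectProperty.trW.mk _ hT (P.mem_of_trW_zero
    (P.prop.trW.comp_mem _ _ (P.trW_act h _) (P.trW_act h _)) hz))

lemma not_trW_right {w w' y : C} (e : w' ⊗ y ≅ 𝟙_ C) (a : 𝟙_ C ⟶ w) {b : 𝟙_ C ⟶ w'}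
    (hb : ¬ P.prop.trW b) : ¬ P.prop.trW (b ≫ act a w') := by
  intro h
  obtain ⟨c, b₂, b₃, hT⟩ := distinguished_cocone_triangle b
  have B := act_act_cone e b b₂ b₃ hT
  have hz : act (b ≫ act a w') c ≫ act (b ≫ act a w') ((w ⊗ w') ⊗ c) = 0 := by
    have h2 := act_naturality b (act a (w' ⊗ c) ≫ (α_ w w' c).inv)
    simp only [Category.assoc] at h2
    rw [act_comp_act, act_comp_act]
    simp only [Category.assoc]
    rw [reassoc_of% h2, reassoc_of% B, zero_comp]
  exact hb (ObjectProperty.trW.mk _ hT (P.mem_of_trW_zero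
    (P.prop.trW.comp_mem _ _ (P.trW_act h _) (P.trW_act h _)) hz))

end Spc

variable [IsTriangulated C]

/-- `x^{⊗ n}` is `⊗`-invertible. -/
def TensorPowers.invIso {x : C} (T : TensorPowers x) (n : ℤ) : T.obj n ⊗ T.obj (-n) ≅ 𝟙_ C :=
  T.mulIso n (-n) ≪≫ T.cast (by simp) ≪≫ T.zero.symm

/-- The comparison map `ρ : Spc C → Spec^•(Hom(𝟙, x^{⊗ •}))`, which sends a prime `P` to
`{f | cone(f) ∉ P}`. Here `P.prop.trW f` says that the cone of `f` is in `P`. -/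
def comparisonMap {x : C} (T : TensorPowers x) (P : Spc C) : HomogeneousSpec T.R where
  piece n :=
    { carrier := {f | ¬ P.prop.trW f}
      zero_mem' := fun h => P.unit_notMem (P.mem_of_trW_zero h rfl)
      add_mem' := fun hf hg => P.not_trW_add (T.invIso n) hf hg
      neg_mem' := fun {f} hf h => hf (by
        have := P.prop.trW.comp_mem _ (-𝟙 (T.obj n)) h
          (by
            have : IsIso (-𝟙 (T.obj n)) := ⟨-𝟙 _, by simp, by simp⟩
            exact P.prop.trW_of_isIso _)
        simpa using this) }
  mul_mem_left {m n} a b hb h := by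
    change P.prop.trW (T.mul a b) at h
    rw [T.mul_eq, P.prop.trW.cancel_right_of_respectsIso] at h
    exact P.not_trW_right (T.invIso n) a hb h
  mul_mem_right {m n} a b ha h := by
    change P.prop.trW (T.mul a b) at h
    rw [T.mul_eq, P.prop.trW.cancel_right_of_respectsIso] at h
    exact P.not_trW_left (T.invIso m) ha b h
  one_notMem h := h (P.prop.trW_of_isIso T.zero.hom)
  mem_or_mem {m n} a b h := by
    by_contra! hab
    refine h ?_
    change P.prop.trW (T.mul a b)
    rw [T.mul_eq]
    exact P.prop.trW.comp_mem _ _ (P.prop.trW.comp_mem _ _ (not_not.1 hab.2)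
      (P.trW_act (not_not.1 hab.1) _)) (P.prop.trW_of_isIso _)

end Comparison

section Statement

/-- A symmetric monoidal category is rigid if every object `X` has a dual `Y`: there are
`η : 𝟙 ⟶ Y ⊗ X` and `ε : X ⊗ Y ⟶ 𝟙` satisfying the triangle identities. -/
def IsRigid (D : Type*) [Category D] [MonoidalCategory D] : Prop :=
  ∀ X : D, ∃ Y : D, Nonempty (ExactPairing Y X)

variable [SymmetricCategory C] [Preadditive C] [HasZeroObject C] [HasShift C ℤ]
  [∀ n : ℤ, (shiftFunctor C n).Additive] [Pretriangulated C] [IsTriangulated C]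
  [TensorTriangulated C]

/-- The map `Spc C → Spc K`, `Q ↦ Q ∩ K`, for a full tensor triangulated subcategory `K`. -/
def Spc.restrict (K : ObjectProperty C) [K.IsMonoidal] [K.IsTriangulated] (Q : Spc C) :
    Spc K.FullSubcategory where
  prop := Q.prop.inverseImage K.ι
  isTriangulated := inferInstance
  isThick := ⟨fun r h => Q.prop.prop_of_retract (r.map K.ι) h⟩
  tensor_mem X Y h := Q.tensor_mem X.obj Y.obj h
  ne_top h := Q.unit_notMem
    (show Q.prop.inverseImage K.ι (𝟙_ K.FullSubcategory) by rw [h]; trivial)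
  mem_or_mem X Y h := Q.mem_or_mem X.obj Y.obj h

/-- The map `Hom_K(𝟙, x^{⊗ n}) → Hom_C(𝟙, x^{⊗ n})` given by the inclusion of the cellular
subcategory `K` in `C`. -/
def TensorPowers.inclusion {x : C} (T : TensorPowers x) {n : ℤ} (f : T.restrict.R n) : T.R n :=
  T.cellular.ι.map f

end Statement

end

end TTGeometry

open TTGeometry

namespace TTGeometry

open Pretriangulated

variable {C : Type u} [Category.{v} C] [MonoidalCategory C] [SymmetricCategory C]
  [Preadditive C] [HasZeroObject C] [HasShift C ℤ]
  [∀ n : ℤ, (shiftFunctor C n).Additive] [Pretriangulated C]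

/-! The substance is the surjectivity of `Spc C → Spc K` for a rigid full tensor triangulated
subcategory `K`; no generators of `K` are needed there. Given a prime `P` of `K`, let `P.extension`
consist of the objects of `C` annihilated by some `ξ : w ⟶ 𝟙` in `K` whose cone lies in `P`. This is
a tt-ideal of `C`. Its trace on `K` is exactly `P`: one inclusion, `mem_of_extension`, holds because
a zero map with cone in `P` has both ends in `P`; the other, `extension_of_mem`, uses rigidity,
taking for `ξ` the fibre of the coevaluation `𝟙 ⟶ Y ⊗ X`. The objects of `K` outside `P` are closed
under `⊗`, since `P` is prime, and they avoid `P.extension`. The tensor analogue of Krull's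
prime-avoidance argument (`Spc.exists_of_isTTIdeal`) then gives a prime `Q` of `C` containing
`P.extension` and avoiding these objects, so `Q ∩ K = P`. The comparison of graded rings is fullness
of `K`, except for products, where the identifications of tensor powers built inside `K` must be
matched with those of `C` (`restrict_mulIso_hom`). Surjectivity of the comparison map for `C` is
then a diagram chase through `Spc K`. -/

/-! ### Tt-ideals and existence of primes by Zorn's lemma. -/

/-- A tt-ideal: a thick triangulated subcategory closed under tensoring with arbitrary objects. -/
structure IsTTIdeal (P : ObjectProperty C) : Prop where
  isTriangulated : P.IsTriangulated
  isThick : P.IsStableUnderRetracts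
  tensor_mem (X Y : C) : P Y → P (X ⊗ Y)

/-- The union of a nonempty chain of tt-ideals is a tt-ideal. -/
lemma IsTTIdeal.of_isChain {c : Set (ObjectProperty C)} (hc : IsChain (· ≤ ·) c)
    (hne : c.Nonempty) (h : ∀ P ∈ c, IsTTIdeal P) :
    IsTTIdeal (fun X : C => ∃ P ∈ c, P X) := by
  obtain ⟨P₀, hP₀⟩ := hne
  have thick : ObjectProperty.IsStableUnderRetracts (fun X : C => ∃ P ∈ c, P X) := by
    refine ⟨fun r ⟨P, hP, hY⟩ => ⟨P, hP, ?_⟩⟩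
    have := (h P hP).isThick
    exact P.prop_of_retract r hY
  refine ⟨?_, thick, fun X Y ⟨P, hP, hY⟩ => ⟨P, hP, (h P hP).tensor_mem X Y hY⟩⟩
  have zero : ObjectProperty.ContainsZero (fun X : C => ∃ P ∈ c, P X) := by
    have := (h P₀ hP₀).isTriangulated
    obtain ⟨Z, hZ, hZ'⟩ := P₀.exists_prop_of_containsZero
    exact ⟨Z, hZ, P₀, hP₀, hZ'⟩
  have shift : ObjectProperty.IsStableUnderShift (fun X : C => ∃ P ∈ c, P X) ℤ := by
    refine ⟨fun n => ⟨fun X ⟨P, hP, hX⟩ => ⟨P, hP, ?_⟩⟩⟩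
    have := (h P hP).isTriangulated
    exact P.le_shift n X hX
  have ext : ObjectProperty.IsTriangulatedClosed₂ (fun X : C => ∃ P ∈ c, P X) := by
    refine .mk' fun T hT ⟨P, hP, h₁⟩ ⟨P', hP', h₃⟩ => ?_
    -- The outer terms may lie in different members of the chain; the larger one contains both.
    obtain ⟨R, hR, h₁, h₃⟩ : ∃ R ∈ c, R T.obj₁ ∧ R T.obj₃ := by
      rcases hc.total hP hP' with hle | hle
      · exact ⟨P', hP', hle _ h₁, h₃⟩
      · exact ⟨P, hP, h₁, hle _ h₃⟩
    have := (h R hR).isTriangulated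
    have := (h R hR).isThick
    exact ⟨R, hR, R.ext_of_isTriangulatedClosed₂ T hT h₁ h₃⟩
  exact { }

variable [TensorTriangulated C]

/-- The ideal quotient `(P : Y) = {X | Y ⊗ X ∈ P}` of a tt-ideal is a tt-ideal. -/
lemma IsTTIdeal.quotient {P : ObjectProperty C} (h : IsTTIdeal P) (Y : C) :
    IsTTIdeal (P.inverseImage (tensorLeft Y)) := by
  have := h.isTriangulated
  have := h.isThick
  exact ⟨inferInstance, ⟨fun r hZ => P.prop_of_retract (r.map (tensorLeft Y)) hZ⟩,
    fun X Z hZ => P.prop_of_iso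
      ((α_ X Y Z).symm ≪≫ whiskerRightIso (β_ X Y) Z ≪≫ α_ Y X Z) (h.tensor_mem X _ hZ)⟩

/-- A tt-ideal disjoint from a set of objects `S` closed under tensor products is contained in a
prime tt-ideal disjoint from `S`. -/
theorem Spc.exists_of_isTTIdeal {J : ObjectProperty C} (hJ : IsTTIdeal J) (S : ObjectProperty C)
    (one : S (𝟙_ C)) (mul : ∀ X Y, S X → S Y → S (X ⊗ Y)) (hJS : ∀ X, S X → ¬ J X) :
    ∃ Q : Spc C, J ≤ Q.prop ∧ ∀ X, S X → ¬ Q.prop X := by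
  obtain ⟨Q, hJQ, ⟨hQ, hQS⟩, hmax⟩ := zorn_le_nonempty₀
    {Q : ObjectProperty C | IsTTIdeal Q ∧ ∀ X, S X → ¬ Q X} (by
      intro c hcs hc y hy
      exact ⟨_, ⟨IsTTIdeal.of_isChain hc ⟨y, hy⟩ fun P hP => (hcs hP).1,
        fun X hX ⟨P, hP, hPX⟩ => (hcs hP).2 X hX hPX⟩, fun P hP X hX => ⟨P, hP, hX⟩⟩) J ⟨hJ, hJS⟩
  have := hQ.isTriangulated
  have := hQ.isThick
  -- The quotient `(Q : X)` contains `Q`, and strictly so because of `Y`; by maximality it must meet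
  -- `S`.
  have meets (X Y : C) (hXY : Q (X ⊗ Y)) (hY : ¬ Q Y) : ∃ s, S s ∧ Q (X ⊗ s) := by
    by_contra! H
    exact hY (hmax (y := Q.inverseImage (tensorLeft X)) ⟨hQ.quotient X, H⟩
      (fun Z hZ => hQ.tensor_mem X Z hZ) Y hXY)
  refine ⟨⟨Q, hQ.isTriangulated, hQ.isThick, hQ.tensor_mem,
    fun h => hQS _ one (by rw [h]; trivial), fun X Y hXY => ?_⟩, hJQ, hQS⟩
  by_contra! hn
  -- Two exchanges replace first `Y`, then `X`, by elements of `S`, putting a product of two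
  -- elements of `S` into `Q`.
  obtain ⟨s, hs, hXs⟩ := meets X Y hXY hn.2
  obtain ⟨t, ht, hst⟩ := meets s X (Q.prop_of_iso (β_ X s) hXs) hn.1
  exact hQS _ (mul s t hs ht) hst

/-! ### Extending a prime of `K` to `C`, and lifting it to a prime. -/

section Extension

/-- If `ξ` annihilates `T.obj₁` and `ζ` annihilates `T.obj₃`, then `ξ ⊗ ζ` annihilates
`T.obj₂`. -/
lemma whiskerRight_comp_eq_zero {T : Triangle C} (hT : T ∈ distTriang C) {w w' : C}
    (ξ : w ⟶ 𝟙_ C) (ζ : w' ⟶ 𝟙_ C) (h₁ : ξ ▷ T.obj₁ = 0) (h₃ : ζ ▷ T.obj₃ = 0) :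
    (w ◁ ζ ≫ (ρ_ w).hom ≫ ξ) ▷ T.obj₂ = 0 := by
  -- Since `ζ` kills `T.obj₃`, the action of `ζ` on `T.obj₂` factors through `T.obj₁`, where `ξ`
  -- then kills it.
  obtain ⟨k, hk⟩ := Triangle.coyoneda_exact₂ T hT (ζ ▷ T.obj₂ ≫ (λ_ T.obj₂).hom) (by
    rw [Category.assoc, ← leftUnitor_naturality, ← whisker_exchange_assoc, h₃]
    simp)
  have h : w ◁ (ζ ▷ T.obj₂ ≫ (λ_ T.obj₂).hom) ≫ ξ ▷ T.obj₂ = 0 := by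
    rw [hk, MonoidalCategory.whiskerLeft_comp, Category.assoc, whisker_exchange, h₁, zero_comp,
      comp_zero]
  have e : (w ◁ ζ ≫ (ρ_ w).hom ≫ ξ) ▷ T.obj₂ =
      (α_ w w' T.obj₂).hom ≫ w ◁ (ζ ▷ T.obj₂ ≫ (λ_ T.obj₂).hom) ≫ ξ ▷ T.obj₂ := by
    simp
  rw [e, h, comp_zero]

lemma Spc.trW_whiskerLeft {P : Spc C} {X Y : C} {f : X ⟶ Y} (hf : P.prop.trW f) (Z : C) :
    P.prop.trW (Z ◁ f) := by
  obtain ⟨W, g, k, hT, hW⟩ := (P.prop.trW_iff _).1 hf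
  exact ObjectProperty.trW.mk _ ((tensorLeft Z).map_distinguished _ hT) (P.tensor_mem Z W hW)

variable {K : ObjectProperty C} [K.IsMonoidal] [K.IsTriangulated]

/-- The objects of `C` annihilated by a morphism `ξ : w ⟶ 𝟙` of `K` whose cone is in `P`. -/
def Spc.extension (P : Spc K.FullSubcategory) : ObjectProperty C := fun X =>
  ∃ (w : K.FullSubcategory) (ξ : w ⟶ 𝟙_ K.FullSubcategory), P.prop.trW ξ ∧ ξ.hom ▷ X = 0

namespace Spc

variable (P : Spc K.FullSubcategory)

instance : P.extension.IsStableUnderRetracts where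
  of_retract := by
    rintro X Y r ⟨w, ξ, hξ, h⟩
    refine ⟨w, ξ, hξ, ?_⟩
    have : ξ.hom ▷ X = w.obj ◁ r.i ≫ ξ.hom ▷ Y ≫ _ ◁ r.r := by
      rw [← whisker_exchange, ← MonoidalCategory.whiskerLeft_comp_assoc, r.retract]
      simp
    rw [this, h, zero_comp, comp_zero]

lemma extension_tensor (X Y : C) (h : P.extension Y) : P.extension (X ⊗ Y) := by
  obtain ⟨w, ξ, hξ, h⟩ := h
  -- The braiding puts `Y` next to `w`, so that the action of `ξ` becomes `(ξ ▷ Y) ▷ X` up to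
  -- associators.
  refine P.extension.prop_of_iso (β_ Y X) ⟨w, ξ, hξ, ?_⟩
  rw [whiskerRight_tensor, h]
  simp

/-- Naturality of `X ⊗ Y⟦n⟧ ≅ (X ⊗ Y)⟦n⟧` in the first variable identifies the action of `ξ` on
`X⟦n⟧` with the shift of its action on `X`. -/
instance : P.extension.IsStableUnderShift ℤ where
  isStableUnderShiftBy n := ⟨by
    rintro X ⟨w, ξ, hξ, h⟩
    refine ⟨w, ξ, hξ, ?_⟩
    have hn := NatTrans.shift_app_comm ((curriedTensor C).map ξ.hom) n X
    dsimp at hn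
    rw [h, Functor.map_zero, comp_zero] at hn
    rw [← cancel_mono (((tensorLeft _).commShiftIso n).hom.app X), zero_comp]
    exact hn.symm⟩

variable [IsTriangulated C]

instance : P.extension.IsTriangulated where
  exists_zero := by
    refine ⟨_, isZero_zero C, 𝟙_ _, 𝟙 _, P.prop.trW_of_isIso _, ?_⟩
    exact ((tensorLeft _).map_isZero (isZero_zero C)).eq_of_tgt _ _
  toIsTriangulatedClosed₂ := .mk' (by
    rintro T hT ⟨w, ξ, hξ, h₁⟩ ⟨w', ζ, hζ, h₃⟩
    -- This is `ξ ⊗ ζ` written as a composite: morphisms with cone in `P` are stable under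
    -- composition and under `w ⊗ -`.
    refine ⟨w ⊗ w', w ◁ ζ ≫ (ρ_ w).hom ≫ ξ, P.prop.trW.comp_mem _ _ (trW_whiskerLeft hζ w)
      (P.prop.trW.comp_mem _ _ (P.prop.trW_of_isIso _) hξ), ?_⟩
    exact whiskerRight_comp_eq_zero hT ξ.hom ζ.hom h₁ h₃)

lemma extension_isTTIdeal : IsTTIdeal P.extension :=
  ⟨inferInstance, inferInstance, P.extension_tensor⟩

/-- The map `X ⊗ ξ : X ⊗ w ⟶ X ⊗ 𝟙` has its cone in `P` and is zero. A shift of its source is then a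
retract of the cone, so the source lies in `P`, and the triangle forces the target `X ⊗ 𝟙 ≅ X` into
`P` as well. -/
lemma mem_of_extension {X : K.FullSubcategory} (h : P.extension X.obj) : P.prop X := by
  obtain ⟨w, ξ, hξ, h⟩ := h
  have hX : X ◁ ξ = 0 := by
    have := BraidedCategory.braiding_naturality_right X ξ
    have h0 : ξ ▷ X = 0 := by
      ext
      exact h
    rwa [h0, comp_zero, ← zero_comp (f := (β_ X (𝟙_ _)).hom), cancel_mono] at this
  have h0 := P.mem_of_trW_zero (trW_whiskerLeft hξ X) hX
  obtain ⟨Z, g, k, hT, hZ⟩ := (P.prop.trW_iff _).1 (trW_whiskerLeft hξ X)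
  have := P.prop.ext_of_isTriangulatedClosed₂ _ hT h0 hZ
  exact P.prop.prop_of_iso (ρ_ X) this

/-- Rigidity enters here. In the triangle `w ⟶ 𝟙 ⟶ Y ⊗ X` on the coevaluation, the cone of `ξ` is `Y
⊗ X`, which lies in `P` with `X`. By the triangle identity `X ⊗ η` is a split monomorphism, so `X ⊗
ξ` vanishes. -/
lemma extension_of_mem (hK : IsRigid K.FullSubcategory) {X : K.FullSubcategory} (h : P.prop X) :
    P.extension X.obj := by
  obtain ⟨Y, ⟨_⟩⟩ := hK X
  obtain ⟨w, ξ, k, hT⟩ := distinguished_cocone_triangle₁ (η_ Y X)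
  have hXξ : X ◁ ξ = 0 := by
    have h0 : X ◁ ξ ≫ X ◁ η_ Y X = 0 := by
      rw [← MonoidalCategory.whiskerLeft_comp]
      have : ξ ≫ η_ Y X = 0 := comp_distTriang_mor_zero₁₂ _ hT
      rw [this, MonoidalPreadditive.whiskerLeft_zero]
    have h1 := X ◁ ξ ≫= ExactPairing.coevaluation_evaluation Y X
    rw [reassoc_of% h0, zero_comp] at h1
    rw [← cancel_mono ((ρ_ X).hom ≫ (λ_ X).inv), ← h1, zero_comp]
  have hξ : ξ ▷ X = 0 := by
    have := BraidedCategory.braiding_naturality_right X ξ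
    rwa [hXξ, zero_comp, ← comp_zero (f := (β_ X w).hom), cancel_epi, eq_comm] at this
  exact ⟨w, ξ, ObjectProperty.trW.mk _ hT (P.tensor_mem _ _ h),
    congrArg InducedCategory.Hom.hom hξ⟩

/-- If `K` is a rigid full tensor triangulated subcategory of `C`, then `Spc C ⟶ Spc K`
is surjective. -/
theorem restrict_surjective (hK : IsRigid K.FullSubcategory) :
    Function.Surjective (Spc.restrict (C := C) K) := by
  intro P
  obtain ⟨Q, hJQ, hQS⟩ := Spc.exists_of_isTTIdeal P.extension_isTTIdeal
    -- The multiplicative set is the complement of `P` in `K`; avoiding it gives `Q ∩ K ≤ P`, while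
    -- containing `P.extension` gives the converse.
    (fun X => ∃ h : K X, ¬ P.prop ⟨X, h⟩) ⟨K.prop_unit, P.unit_notMem⟩
    (fun X Y ⟨hX, hX'⟩ ⟨hY, hY'⟩ => ⟨K.prop_tensor hX hY, fun h =>
      (P.mem_or_mem ⟨X, hX⟩ ⟨Y, hY⟩ h).elim hX' hY'⟩)
    (fun X ⟨hX, hX'⟩ h => hX' (P.mem_of_extension (X := ⟨X, hX⟩) h))
  refine ⟨Q, ?_⟩
  have : (Q.restrict K).prop = P.prop := by
    ext X
    exact ⟨fun h => by_contra fun hX => hQS X.obj ⟨X.property, hX⟩ h,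
      fun h => hJQ _ (P.extension_of_mem hK h)⟩
  -- The remaining fields of `Spc` are propositions, so equality of the underlying properties
  -- suffices.
  revert this
  cases P
  cases hQ : Q.restrict K
  rintro rfl
  rfl

end Spc

end Extension

/-! ### Comparison of the graded rings and of their homogeneous spectra. -/

section Inclusion

variable [IsTriangulated C] {x : C} (T : TensorPowers x)

namespace TensorPowers

/-- In negative degrees the two sides are preimages under full faithfulness of `- ⊗ x` in two
different categories, so they do not agree by unfolding. Both families satisfy the recursion
`MulRel` and agree in degree `0`, which determines them. -/
lemma restrict_mulIso_hom (m n : ℤ) :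
    (T.restrict.mulIso m n).hom.hom = (T.mulIso m n).hom := by
  have cast_hom {a b : ℤ} (h : a = b) : (T.restrict.cast h).hom.hom = (T.cast h).hom := by
    subst h; rfl
  have succ'_hom (a b : ℤ) (h : a + 1 = b) :
      (T.restrict.succ' a b h).hom.hom = (T.succ' a b h).hom := by
    subst h
    change (T.succ a).hom ≫ 𝟙 _ = (T.succ a).hom ≫ 𝟙 _
    rfl
  refine T.eq_of_mulRel (l := m) (X := T.obj m) (fun n => (T.restrict.mulIso m n).hom.hom)
    (fun n => (T.mulIso m n).hom) ?_ (fun a => T.mulIso_rel m rfl) ?_ n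
  · intro a
    have h := congrArg InducedCategory.Hom.hom (T.restrict.mulIso_rel m (a := a) rfl)
    dsimp at h
    rwa [succ'_hom, succ'_hom] at h
  · have h := congrArg InducedCategory.Hom.hom (T.restrict.mulIso_zero m)
    refine h.trans ((?_ : _ = _).trans (T.mulIso_zero m).symm)
    exact congrArg (fun f => T.obj m ◁ T.zero.inv ≫ (ρ_ _).hom ≫ f) (cast_hom _)

lemma inclusion_bijective (n : ℤ) : Function.Bijective (T.inclusion (n := n)) :=
  ⟨T.cellular.ι.map_injective, T.cellular.ι.map_surjective⟩

lemma inclusion_add {n : ℤ} (f g : T.restrict.R n) :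
    T.inclusion (f + g) = T.inclusion f + T.inclusion g := rfl

lemma inclusion_one : T.inclusion (GradedMonoid.GOne.one : T.restrict.R 0) =
    GradedMonoid.GOne.one := rfl

lemma inclusion_mul {m n : ℤ} (f : T.restrict.R m) (g : T.restrict.R n) :
    T.inclusion (GradedMonoid.GMul.mul f g : T.restrict.R (m + n)) =
      GradedMonoid.GMul.mul (T.inclusion f) (T.inclusion g) :=
  congrArg (fun h => (λ_ (𝟙_ C)).inv ≫ (f.hom ⊗ₘ g.hom) ≫ h) (T.restrict_mulIso_hom m n)

/-- The homogeneous prime of `Hom_K(𝟙, x^{⊗ •})` corresponding to a homogeneous prime of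
`Hom_C(𝟙, x^{⊗ •})`. -/
def comapInclusion (p : HomogeneousSpec T.R) : HomogeneousSpec T.restrict.R where
  piece n := (p.piece n).comap (AddMonoidHom.mk' T.inclusion T.inclusion_add)
  mul_mem_left a _ hb := by
    rw [AddSubgroup.mem_comap, AddMonoidHom.mk'_apply, inclusion_mul]
    exact p.mul_mem_left _ hb
  mul_mem_right b ha := by
    rw [AddSubgroup.mem_comap, AddMonoidHom.mk'_apply, inclusion_mul]
    exact p.mul_mem_right _ ha
  one_notMem := p.one_notMem
  mem_or_mem a b h := by
    rw [AddSubgroup.mem_comap, AddMonoidHom.mk'_apply, inclusion_mul] at h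
    exact p.mem_or_mem _ _ h

/-- The inclusion is exact, so a cone of `f` in `K` is also a cone in `C`, and it lies in `Q ∩ K`
exactly when it lies in `Q`. -/
lemma mem_comparisonMap_restrict_iff (Q : Spc C) {n : ℤ} (f : T.restrict.R n) :
    f ∈ (comparisonMap T.restrict (Q.restrict T.cellular)).piece n ↔
      T.inclusion f ∈ (comparisonMap T Q).piece n :=
  not_congr (Q.prop.inverseImage_trW_iff T.cellular.ι f)

/-- If every prime of the cellular subcategory is the restriction of a prime of `C`, surjectivity
of the comparison map can be tested on the cellular subcategory. -/
lemma comparisonMap_surjective_of_restrict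
    (hT : Function.Surjective (Spc.restrict (C := C) T.cellular))
    (h : Function.Surjective (comparisonMap T.restrict)) :
    Function.Surjective (comparisonMap T) := by
  intro p
  obtain ⟨P, hP⟩ := h (T.comapInclusion p)
  obtain ⟨Q, rfl⟩ := hT P
  refine ⟨Q, ?_⟩
  have : (comparisonMap T Q).piece = p.piece := by
    funext n
    ext g
    -- Every homogeneous element comes from `K`, so a homogeneous prime of the larger ring is
    -- determined by its pullback.
    obtain ⟨f, rfl⟩ := (T.inclusion_bijective n).2 g
    rw [← mem_comparisonMap_restrict_iff, hP]
    rfl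
  revert this
  cases p
  cases comparisonMap T Q
  rintro rfl
  rfl

end TensorPowers

end Inclusion

end TTGeometry

theorem corollary1p8 {L : Type u} [Category.{v} L] [MonoidalCategory L] [SymmetricCategory L]
    [Preadditive L] [HasZeroObject L] [HasShift L ℤ] [∀ n : ℤ, (shiftFunctor L n).Additive]
    [Pretriangulated L] [IsTriangulated L] [TensorTriangulated L]
    (u : L) (hu : IsTensorInvertible u)
    (hK : IsRigid hu.powers.cellular.FullSubcategory) :
    -- the inclusion is an isomorphism of graded rings
    ((∀ n : ℤ, Function.Bijective (hu.powers.inclusion (n := n))) ∧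
      (∀ (n : ℤ) (f g : hu.powers.restrict.R n),
        hu.powers.inclusion (f + g) = hu.powers.inclusion f + hu.powers.inclusion g) ∧
      hu.powers.inclusion (GradedMonoid.GOne.one : hu.powers.restrict.R 0) =
        GradedMonoid.GOne.one ∧
      (∀ (m n : ℤ) (f : hu.powers.restrict.R m) (g : hu.powers.restrict.R n),
        hu.powers.inclusion (GradedMonoid.GMul.mul f g : hu.powers.restrict.R (m + n)) =
          GradedMonoid.GMul.mul (hu.powers.inclusion f) (hu.powers.inclusion g))) ∧
    -- the square of comparison maps commutes, and its top map is surjective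
    (∀ (Q : Spc L) (n : ℤ) (f : hu.powers.restrict.R n),
      f ∈ (comparisonMap hu.powers.restrict (Q.restrict hu.powers.cellular)).piece n ↔
        hu.powers.inclusion f ∈ (comparisonMap hu.powers Q).piece n) ∧
    Function.Surjective (Spc.restrict (C := L) hu.powers.cellular) ∧
    -- surjectivity can be tested on the cellular subcategory
    (Function.Surjective (comparisonMap hu.powers.restrict) →
      Function.Surjective (comparisonMap hu.powers)) :=
  ⟨⟨hu.powers.inclusion_bijective, fun _ => hu.powers.inclusion_add, hu.powers.inclusion_one,
      fun _ _ => hu.powers.inclusion_mul⟩,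
    fun Q _ => hu.powers.mem_comparisonMap_restrict_iff Q, Spc.restrict_surjective hK,
    hu.powers.comparisonMap_surjective_of_restrict (Spc.restrict_surjective hK)⟩
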